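/- Let $k$ be a commutative ring, $G$ a group, and let $kG\text{-Mod}$ be the category of modules over the group algebra $kG$. For $kG$-modules $M,N$, the group $G$ acts diagonally on $M\otimes_k N$ by $g(x\otimes y)=gx\otimes gy$ and on $\mathrm{Hom}_k(M,N)$ by $(g\cdot f)(x)=g\,f(g^{-1}x)$. Let $B$ be the $kG$-module of all functions $G\to k$ taking only finitely many values, with $(g\cdot f)(x)=f(g^{-1}x)$. A $kG$-module $M$ is called fibrant if the diagonal $kG$-module $\mathrm{Hom}_k(B,M)$ is injective; $\mathrm{Fib}(kG)$ denotes the class of fibrant modules. For a class $\mathcal A$ of $kG$-modules, let $${}^{\perp}\mathcal A=\{E:\mathrm{Ext}^1_{kG}(E,A)=0\ \ \forall A\in\mathcal A\},\qquad \mathcal A^{\perp}=\{E:\mathrm{Ext}^1_{kG}(A,E)=0\ \ \forall A\in\mathcal A\}.$$ **Theorem 4.5.** The pair $(\mathcal C,\mathcal D)=({}^{\perp}\mathrm{Fib}(kG),\mathrm{Fib}(kG))$ has the following properties. 1. It is a cotorsion pair in $kG\text{-Mod}$, i.e. $\mathcal C={}^{\perp}\mathcal D$ and $\mathcal C^{\perp}=\mathcal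 D$. 2. It is hereditary, i.e. $\mathrm{Ext}^i_{kG}(C,D)=0$ for all $i>0$, $C\in\mathcal C$ and $D\in\mathcal D$. 3. It is cogenerated by a set: there is a set $\mathcal T$ of cyclic $kG$-modules such that every cyclic $kG$-module is isomorphic to a member of $\mathcal T$, and for every such set $\mathcal T$, $\mathcal S=\{C\otimes_k B: C\in\mathcal T\}$ is a set with $\mathcal D=\mathcal S^{\perp}$ and $\mathcal C={}^{\perp}(\mathcal S^{\perp})$. 4. Its kernel $\mathcal C\cap\mathcal D={}^{\perp}\mathrm{Fib}(kG)\cap\mathrm{Fib}(kG)$ is the class of injective $kG$-modules. -/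

import Mathlib

open CategoryTheory

universe u v

namespace CotorsionPairs

section Orthogonals

variable {R : Type u} [Ring R] [Small.{v} R]

/-- The class of all modules `E` with `Ext¹(E, A) = 0` for every `A` in the class `𝒜`. -/
def leftOrth (𝒜 : ObjectProperty (ModuleCat.{v} R)) : ObjectProperty (ModuleCat.{v} R) :=
  fun E => ∀ A, 𝒜 A → Subsingleton (Abelian.Ext.{v} E A 1)

/-- The class of all modules `E` with `Ext¹(A, E) = 0` for every `A` in the class `𝒜`. -/
def rightOrth (𝒜 : ObjectProperty (ModuleCat.{v} R)) : ObjectProperty (ModuleCat.{v} R) :=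
  fun E => ∀ A, 𝒜 A → Subsingleton (Abelian.Ext.{v} A E 1)

/-- `(𝒞, 𝒟)` is a cotorsion pair in the category of all `R`-modules. -/
structure IsCotorsionPair (𝒞 𝒟 : ObjectProperty (ModuleCat.{v} R)) : Prop where
  left_eq : 𝒞 = leftOrth 𝒟
  right_eq : rightOrth 𝒞 = 𝒟

/-- All `Extⁱ(C, D)`, `i > 0`, vanish for `C` in `𝒞` and `D` in `𝒟`. -/
def IsHereditary (𝒞 𝒟 : ObjectProperty (ModuleCat.{v} R)) : Prop :=
  ∀ C D, 𝒞 C → 𝒟 D → ∀ i : ℕ, 0 < i → Subsingleton (Abelian.Ext.{v} C D i)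

/-- `(𝒞, 𝒟)` is cogenerated by `S`, and `S` is a set (rather than a proper class): it is small
with respect to the universe of the modules. -/
structure IsCogeneratedBySet (𝒞 𝒟 : ObjectProperty (ModuleCat.{v} R))
    (S : Set (ModuleCat.{v} R)) : Prop where
  small : Small.{v} S
  right_eq : 𝒟 = rightOrth (fun X => X ∈ S)
  left_eq : 𝒞 = leftOrth (rightOrth (fun X => X ∈ S))

/-- The module `C` is generated by one element. -/
def IsCyclicModule (C : ModuleCat.{v} R) : Prop :=
  ∃ x : C, Submodule.span R {x} = ⊤

/-- `T` is a set (not a proper class) of cyclic modules that meets every isomorphism class of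
cyclic modules. -/
structure IsSetOfCyclicRepresentatives (T : Set (ModuleCat.{v} R)) : Prop where
  small : Small.{v} T
  cyclic : ∀ C ∈ T, IsCyclicModule C
  exists_iso : ∀ C : ModuleCat.{v} R, IsCyclicModule C → ∃ C' ∈ T, Nonempty (C ≅ C')

/-- The class of injective modules. -/
def injectives : ObjectProperty (ModuleCat.{v} R) :=
  fun M => Module.Injective R M

end Orthogonals

section GroupAlgebra

variable (k : Type u) [CommRing k] (G : Type v) [Group G]

/-- The `k`-module of functions `G → k` that take only finitely many values. -/
def finValued : Submodule k (G → k) where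
  carrier := {f | (Set.range f).Finite}
  zero_mem' := (Set.finite_singleton (0 : k)).subset (by rintro _ ⟨x, rfl⟩; simp)
  add_mem' {f g} hf hg := (Set.Finite.image2 (fun a b => a + b) hf hg).subset (by
    rintro _ ⟨x, rfl⟩
    exact ⟨f x, ⟨x, rfl⟩, g x, ⟨x, rfl⟩, rfl⟩)
  smul_mem' c f hf := (Set.Finite.image (fun a => c • a) hf).subset (by
    rintro _ ⟨x, rfl⟩
    exact ⟨f x, ⟨x, rfl⟩, rfl⟩)

/-- The action of `G` on finitely-valued functions by left translation,
`(g • f) x = f (g⁻¹ * x)`. -/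
def finValuedRep : Representation k G (finValued k G) where
  toFun g :=
    { toFun f := ⟨fun x => f.1 (g⁻¹ * x), f.2.subset (by
        rintro _ ⟨x, rfl⟩
        exact ⟨g⁻¹ * x, rfl⟩)⟩
      map_add' _ _ := rfl
      map_smul' _ _ := rfl }
  map_one' := by
    ext f x
    simp
  map_mul' g h := by
    ext f x
    simp [mul_assoc]

/-- The `kG`-module `B` of finitely-valued functions `G → k`. -/
noncomputable def moduleB : ModuleCat.{max u v} (MonoidAlgebra k G) :=
  Rep.toModuleMonoidAlgebra.obj (Rep.of (finValuedRep k G))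

variable {k G}

/- Below, `Rep.ofModuleMonoidAlgebra` and `Rep.toModuleMonoidAlgebra` translate between
`kG`-modules and `k`-linear representations of `G` without changing the underlying set. -/

/-- The diagonal `kG`-module `M ⊗ₖ N`, with `g • (x ⊗ y) = (g • x) ⊗ (g • y)`. -/
noncomputable def diagTensor (M N : ModuleCat.{max u v} (MonoidAlgebra k G)) :
    ModuleCat.{max u v} (MonoidAlgebra k G) :=
  Rep.toModuleMonoidAlgebra.obj (Rep.of
    ((Rep.ofModuleMonoidAlgebra.obj M).ρ.tprod (Rep.ofModuleMonoidAlgebra.obj N).ρ))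

/-- The diagonal `kG`-module `Homₖ(M, N)`, with `(g • f) x = g • f (g⁻¹ • x)`. -/
noncomputable def diagHom (M N : ModuleCat.{max u v} (MonoidAlgebra k G)) :
    ModuleCat.{max u v} (MonoidAlgebra k G) :=
  Rep.toModuleMonoidAlgebra.obj (Rep.of
    ((Rep.ofModuleMonoidAlgebra.obj M).ρ.linHom (Rep.ofModuleMonoidAlgebra.obj N).ρ))

variable (k G)

/-- The class of fibrant modules: those `M` for which the diagonal module `Homₖ(B, M)` is
injective. -/
def fibrants : ObjectProperty (ModuleCat.{max u v} (MonoidAlgebra k G)) :=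
  fun M => injectives (diagHom (moduleB k G) M)

end GroupAlgebra

end CotorsionPairs

open CotorsionPairs

/-! Write `L = - ⊗ₖ B` and `R = Homₖ(B, -)`, with diagonal actions, so that `L ⊣ R`. By Nöbeling's
theorem `B` is free over `k` (`free_finValued`), so `L` preserves monomorphisms, `R` is exact and
`R` preserves injectives. Hence `Ext¹(L X, D)` vanishes exactly when `Ext¹(X, R D)` does
(`subsingleton_ext_one_adjunction_iff`). By Baer's criterion `R D` is injective iff `Ext¹(C, R D) =
0` for all cyclic `C`, so the fibrant modules are the right orthogonal of the modules `C ⊗ₖ B`. This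
gives the cotorsion pair and its cogenerating set. Fibrant modules are closed under cosyzygies, and
dimension shifting makes the pair hereditary.

For the kernel, use that `B` is an algebra with invariant unit. Evaluation at the unit is an
epimorphism `ε : R M ⟶ M`, and the multiplication of `B` splits `R(ε)`. If `M` is fibrant, then so
is `ker ε`; if also `M ∈ 𝒞`, then `ε` splits and `M` is a retract of the injective `R M`. Conversely
an injective `I` is fibrant, and it is a retract of `L I ∈ 𝒞` through `x ↦ x ⊗ 1`. -/

namespace CotorsionPairs

open Limits Abelian

/-! ### Ext and adjunctions in an abelian category. -/

section Abstract

universe w w' u'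

variable {C : Type u'} [Category.{w'} C] [Abelian C] [HasExt.{w} C]

/-- For a short exact sequence `0 → D → J → D' → 0` with `J` injective, `Ext¹(X, D) = 0` if and
only if every map `X ⟶ D'` lifts to `J`. -/
lemma subsingleton_ext_one_iff_exists_lift {S : ShortComplex C} (hS : S.ShortExact)
    [Injective S.X₂] (X : C) :
    Subsingleton (Ext.{w} X S.X₁ 1) ↔ ∀ f : X ⟶ S.X₃, ∃ g : X ⟶ S.X₂, g ≫ S.g = f := by
  constructor
  · intro _ f
    obtain ⟨x, hx⟩ := Ext.covariant_sequence_exact₃ X hS (Ext.mk₀ f) (zero_add 1)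
      (Subsingleton.elim _ _)
    obtain ⟨g, rfl⟩ := Ext.addEquiv₀.symm.surjective x
    exact ⟨g, Ext.addEquiv₀.symm.injective (by simpa using hx)⟩
  · refine fun h => subsingleton_of_forall_eq 0 fun x => ?_
    obtain ⟨y, rfl⟩ := Ext.covariant_sequence_exact₁ X hS x (Ext.eq_zero_of_injective _)
      (zero_add 1)
    obtain ⟨f, rfl⟩ := Ext.addEquiv₀.symm.surjective y
    obtain ⟨g, rfl⟩ := h f
    simp [← Ext.mk₀_comp_mk₀]

lemma subsingleton_ext_succ_of_shortExact {S : ShortComplex C} (hS : S.ShortExact)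
    [Injective S.X₂] (X : C) (n : ℕ) [Subsingleton (Ext.{w} X S.X₃ n)] :
    Subsingleton (Ext.{w} X S.X₁ (n + 1)) := by
  refine subsingleton_of_forall_eq 0 fun x => ?_
  obtain ⟨y, rfl⟩ := Ext.covariant_sequence_exact₁ X hS x (Ext.eq_zero_of_injective _) rfl
  simp [Subsingleton.elim y 0]

lemma exists_section_of_subsingleton_ext {S : ShortComplex C} (hS : S.ShortExact)
    [Subsingleton (Ext.{w} S.X₃ S.X₁ 1)] : ∃ s : S.X₃ ⟶ S.X₂, s ≫ S.g = 𝟙 _ := by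
  obtain ⟨x, hx⟩ := Ext.covariant_sequence_exact₃ S.X₃ hS (Ext.mk₀ (𝟙 _)) (zero_add 1)
    (Subsingleton.elim _ _)
  obtain ⟨g, rfl⟩ := Ext.addEquiv₀.symm.surjective x
  exact ⟨g, Ext.addEquiv₀.symm.injective (by simpa using hx)⟩

lemma subsingleton_ext_of_retract {X Y : C} (r : Retract X Y) (D : C) (n : ℕ)
    [Subsingleton (Ext.{w} Y D n)] : Subsingleton (Ext.{w} X D n) := by
  refine subsingleton_of_forall_eq 0 fun x => ?_
  have h : (Ext.mk₀ r.i).comp ((Ext.mk₀ r.r).comp x (zero_add n)) (zero_add n) = x := by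
    simp
  rw [← h, Subsingleton.elim ((Ext.mk₀ r.r).comp x (zero_add n)) 0, Ext.comp_zero]

omit [HasExt.{w} C] in
/-- Every object is the first term of a short exact sequence with injective middle term. -/
lemma exists_shortExact_injective [EnoughInjectives C] (D : C) :
    ∃ S : ShortComplex C, S.ShortExact ∧ Injective S.X₂ ∧ S.X₁ = D :=
  ⟨.mk (Injective.ι D) (cokernel.π _) (cokernel.condition _),
    .mk' (ShortComplex.exact_cokernel _) inferInstance inferInstance,
    inferInstanceAs (Injective (Injective.under D)), rfl⟩

omit [Abelian C] [HasExt.{w} C] in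
lemma exists_retraction_of_injective {I Y : C} [Injective I] (f : I ⟶ Y) [Mono f] :
    Nonempty (Retract I Y) :=
  ⟨⟨f, Injective.factorThru (𝟙 I) f, Injective.comp_factorThru _ _⟩⟩

variable {L R : C ⥤ C} (adj : L ⊣ R)

-- A right adjoint preserves kernels, so only the preservation of epimorphisms has to be assumed.
omit [HasExt.{w} C] in
include adj in
lemma shortExact_map_rightAdjoint [R.PreservesEpimorphisms] [R.PreservesZeroMorphisms]
    {S : ShortComplex C} (hS : S.ShortExact) : (S.map R).ShortExact := by
  have := hS.mono_f
  have := hS.epi_g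
  have := adj.rightAdjoint_preservesLimits
  have : Mono (S.map R).f := inferInstanceAs (Mono (R.map S.f))
  have : Epi (S.map R).g := inferInstanceAs (Epi (R.map S.g))
  have : PreservesFiniteLimits R := inferInstance
  refine .mk' ?_ inferInstance inferInstance
  exact ((S.map R).exact_of_f_is_kernel (KernelFork.mapIsLimit _ hS.fIsKernel R))

include adj in
/-- `Ext¹(L X, D)` vanishes if and only if `Ext¹(X, R D)` does, for an adjunction `L ⊣ R` between
functors exact enough for this. -/
lemma subsingleton_ext_one_adjunction_iff [EnoughInjectives C] [L.PreservesMonomorphisms]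
    [R.PreservesEpimorphisms] [R.PreservesZeroMorphisms] (X D : C) :
    Subsingleton (Ext.{w} (L.obj X) D 1) ↔ Subsingleton (Ext.{w} X (R.obj D) 1) := by
  obtain ⟨S, hS, _, rfl⟩ := exists_shortExact_injective D
  have : Injective (S.map R).X₂ := Injective.injective_of_adjoint adj S.X₂
  refine (subsingleton_ext_one_iff_exists_lift hS (L.obj X)).trans
    (Iff.trans ?_ (subsingleton_ext_one_iff_exists_lift
      (shortExact_map_rightAdjoint adj hS) X).symm)
  constructor
  · intro h a
    obtain ⟨b, hb⟩ := h ((adj.homEquiv _ _).symm a)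
    refine ⟨adj.homEquiv _ _ b, ?_⟩
    exact ((adj.homEquiv_naturality_right b S.g).symm.trans
      (congrArg (adj.homEquiv _ _) hb)).trans (Equiv.apply_symm_apply _ _)
  · intro h a
    obtain ⟨b, hb⟩ := h (adj.homEquiv _ _ a)
    refine ⟨(adj.homEquiv _ _).symm b, ?_⟩
    exact ((adj.homEquiv_naturality_right_symm b S.g).symm.trans
      (congrArg (adj.homEquiv _ _).symm hb)).trans (Equiv.symm_apply_apply _ _)

omit [HasExt.{w} C] in
include adj in
/-- The objects with injective image under `R` are closed under cosyzygies. -/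
lemma injective_obj_cosyzygy [L.PreservesMonomorphisms]
    [R.PreservesEpimorphisms] [R.PreservesZeroMorphisms] {S : ShortComplex C}
    (hS : S.ShortExact) [Injective S.X₂] [Injective (R.obj S.X₁)] : Injective (R.obj S.X₃) := by
  have hRS := shortExact_map_rightAdjoint adj hS
  have : Injective (S.map R).X₁ := ‹_›
  have : Injective (S.map R).X₂ := Injective.injective_of_adjoint adj S.X₂
  -- The image sequence splits because its first term is injective, so its third term is a retract
  -- of the injective middle one.
  obtain s := hRS.splittingOfInjective
  exact Retract.injective (Y := (S.map R).X₂) ⟨s.s, R.map S.g, s.s_g⟩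

include adj in
/-- If `Ext¹(X, D) = 0` for all `D` with `R D` injective, the same holds for all higher `Ext`. -/
lemma subsingleton_ext_of_injective_rightAdjoint_obj [EnoughInjectives C]
    [L.PreservesMonomorphisms] [R.PreservesEpimorphisms] [R.PreservesZeroMorphisms] {X : C}
    (hX : ∀ D, Injective (R.obj D) → Subsingleton (Ext.{w} X D 1)) (n : ℕ) (D : C)
    (hD : Injective (R.obj D)) : Subsingleton (Ext.{w} X D (n + 1)) := by
  induction n generalizing D with
  | zero => exact hX D hD
  | succ n ih =>
    obtain ⟨S, hS, _, rfl⟩ := exists_shortExact_injective D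
    have := ih S.X₃ (injective_obj_cosyzygy adj hS)
    exact subsingleton_ext_succ_of_shortExact hS X (n + 1)

omit [HasExt.{w} C] in
include adj in
/-- If `ε : R M ⟶ M` is an epimorphism with `R(ε)` split, and `R M` is injective, then `R` maps the
kernel of `ε` to an injective object. -/
lemma injective_obj_kernel [L.PreservesMonomorphisms] [R.PreservesEpimorphisms]
    [R.PreservesZeroMorphisms] {M : C} (ε : R.obj M ⟶ M) [Epi ε] (δ : R.obj M ⟶ R.obj (R.obj M))
    (h : δ ≫ R.map ε = 𝟙 _) [Injective (R.obj M)] : Injective (R.obj (kernel ε)) := by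
  let S := ShortComplex.mk (kernel.ι ε) ε (kernel.condition ε)
  have hS : S.ShortExact := .mk' (ShortComplex.exact_kernel ε) inferInstance inferInstance
  have hRS := shortExact_map_rightAdjoint adj hS
  have : Injective (R.obj (R.obj M)) := Injective.injective_of_adjoint adj _
  have := hRS.mono_f
  let s := ShortComplex.Splitting.ofExactOfSection (S.map R) hRS.exact δ h hRS.mono_f
  exact Retract.injective (Y := R.obj (R.obj M)) ⟨R.map S.f, s.r, s.f_r⟩

include adj in
/-- An object `M` with `R M` injective that is left orthogonal to all such objects is injective. -/
lemma injective_of_subsingleton_ext [L.PreservesMonomorphisms] [R.PreservesEpimorphisms]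
    [R.PreservesZeroMorphisms] {M : C} (ε : R.obj M ⟶ M) [Epi ε] (δ : R.obj M ⟶ R.obj (R.obj M))
    (h : δ ≫ R.map ε = 𝟙 _) [Injective (R.obj M)]
    (hM : ∀ D, Injective (R.obj D) → Subsingleton (Ext.{w} M D 1)) : Injective M := by
  let S := ShortComplex.mk (kernel.ι ε) ε (kernel.condition ε)
  have hS : S.ShortExact := .mk' (ShortComplex.exact_kernel ε) inferInstance inferInstance
  have : Subsingleton (Ext.{w} S.X₃ S.X₁ 1) := hM _ (injective_obj_kernel adj ε δ h)
  obtain ⟨s, hs⟩ := exists_section_of_subsingleton_ext hS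
  exact Retract.injective (Y := R.obj M) ⟨s, ε, hs⟩

-- `η` splits, so `I` is a retract of `L.obj I`, and the latter is orthogonal to `D` because
-- `Ext¹(I, R D) = 0`.
include adj in
lemma subsingleton_ext_of_injective_of_mono [EnoughInjectives C] [L.PreservesMonomorphisms]
    [R.PreservesEpimorphisms] [R.PreservesZeroMorphisms] {I : C} [Injective I] (η : I ⟶ L.obj I)
    [Mono η] (D : C) [Injective (R.obj D)] : Subsingleton (Ext.{w} I D 1) := by
  obtain ⟨r⟩ := exists_retraction_of_injective η
  have : Subsingleton (Ext.{w} (L.obj I) D 1) :=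
    (subsingleton_ext_one_adjunction_iff adj I D).2
      (subsingleton_of_forall_eq 0 Ext.eq_zero_of_injective)
  exact subsingleton_ext_of_retract r D 1

end Abstract

/-! ### Cyclic modules and Baer's criterion. -/

section Cyclic

variable {R : Type u} [Ring R]

lemma isCyclicModule_quotient (I : Submodule R R) :
    IsCyclicModule (ModuleCat.of R (R ⧸ I)) := by
  refine ⟨Submodule.Quotient.mk (p := I) 1, ?_⟩
  rw [eq_top_iff]
  rintro x -
  obtain ⟨r, rfl⟩ := Submodule.Quotient.mk_surjective I x
  refine Submodule.mem_span_singleton.2 ⟨r, ?_⟩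
  rw [← Submodule.Quotient.mk_smul, smul_eq_mul, mul_one]

/-- A module `M` with `Ext¹(C, M) = 0` for all cyclic modules `C` is injective. -/
lemma injective_of_subsingleton_ext_cyclic (M : ModuleCat.{u} R)
    (h : ∀ C : ModuleCat.{u} R, IsCyclicModule C → Subsingleton (Ext.{u} C M 1)) :
    Module.Injective R M := by
  refine Module.Baer.injective fun I g => ?_
  let S := ShortComplex.mk (ModuleCat.ofHom I.subtype) (ModuleCat.ofHom I.mkQ) (by
    ext x; simp)
  have hS : S.ShortExact :=
    { exact := by
        rw [ShortComplex.moduleCat_exact_iff]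
        intro x hx
        exact ⟨⟨x, by simpa [S] using hx⟩, rfl⟩
      mono_f := (ModuleCat.mono_iff_injective _).2 I.injective_subtype
      epi_g := (ModuleCat.epi_iff_surjective _).2 I.mkQ_surjective }
  -- The obstruction to extending `g` from `I` to `R` lies in `Ext¹(R ⧸ I, M)`, and `R ⧸ I` is
  -- cyclic.
  have : Subsingleton (Ext.{u} S.X₃ M 1) := h _ (isCyclicModule_quotient I)
  obtain ⟨x, hx⟩ := Ext.contravariant_sequence_exact₁ hS M
    (Ext.mk₀ (ModuleCat.ofHom g : S.X₁ ⟶ M)) (add_zero 1) (Subsingleton.elim _ _)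
  obtain ⟨f, rfl⟩ := Ext.addEquiv₀.symm.surjective x
  have hf : S.f ≫ f = ModuleCat.ofHom g := Ext.addEquiv₀.symm.injective (by simpa using hx)
  exact ⟨f.hom, fun y hy => congr($(hf).hom ⟨y, hy⟩)⟩

lemma exists_isSetOfCyclicRepresentatives :
    ∃ T : Set (ModuleCat.{u} R), IsSetOfCyclicRepresentatives T := by
  refine ⟨Set.range fun I : Submodule R R => ModuleCat.of R (R ⧸ I), inferInstance, ?_, ?_⟩
  · rintro _ ⟨I, rfl⟩
    exact isCyclicModule_quotient I
  · rintro C ⟨x, hx⟩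
    refine ⟨_, ⟨LinearMap.ker (LinearMap.toSpanSingleton R C x), rfl⟩, ⟨?_⟩⟩
    refine (LinearEquiv.toModuleIso (LinearMap.quotKerEquivOfSurjective _ ?_)).symm
    rw [← LinearMap.range_eq_top, LinearMap.range_toSpanSingleton, hx]

end Cyclic

/-! ### Freeness of the module of finitely-valued functions. -/

section FiniteValued

open TensorProduct

variable (R : Type*) [CommRing R] {X : Type*}

/-- The indicator function of a set, as a finitely-valued function. -/
noncomputable def finValuedIndicator (s : Set X) : finValued R X :=
  ⟨s.indicator 1, (Set.toFinite {0, 1}).subset (by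
    rintro _ ⟨x, rfl⟩
    by_cases h : x ∈ s <;> simp [h])⟩

variable {R}

/-- A function that factors through a function with finite range is a linear combination of
indicators of the fibres of the latter. -/
lemma eq_sum_smul_finValuedIndicator {Y : Type*} {φ : X → Y} (hφ : (Set.range φ).Finite)
    (h : Y → R) (f : finValued R X) (hf : ∀ x, f.1 x = h (φ x)) :
    f = ∑ y ∈ hφ.toFinset, h y • finValuedIndicator R (φ ⁻¹' {y}) := by
  ext x
  rw [hf x, AddSubmonoidClass.coe_finsetSum, Finset.sum_apply,
    Finset.sum_eq_single (φ x)]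
  · simp [finValuedIndicator]
  · intro y _ hy
    simp [finValuedIndicator, hy.symm]
  · simp

variable (R X)

/-- Evaluation of locally constant functions on ultrafilters at the principal ultrafilters. -/
noncomputable def locallyConstantUltrafilterRestrict :
    LocallyConstant (Ultrafilter X) R →ₗ[R] finValued R X where
  toFun f := ⟨fun x => f (pure x), f.range_finite.subset (Set.range_comp_subset_range pure f)⟩
  map_add' _ _ := rfl
  map_smul' _ _ := rfl

/-- Principal ultrafilters are dense, which gives injectivity. For surjectivity, the indicator of a
set extends to that of the clopen set of ultrafilters containing it. -/
lemma locallyConstantUltrafilterRestrict_bijective :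
    Function.Bijective (locallyConstantUltrafilterRestrict R X) := by
  classical
  constructor
  · intro f g h
    let _ : TopologicalSpace R := ⊥
    have : DiscreteTopology R := ⟨rfl⟩
    refine LocallyConstant.coe_injective
      (denseRange_pure.equalizer f.continuous g.continuous ?_)
    ext x
    exact congrFun (congrArg Subtype.val h) x
  · rw [← LinearMap.range_eq_top, eq_top_iff]
    rintro f -
    rw [eq_sum_smul_finValuedIndicator f.2 id f fun _ => rfl]
    refine Submodule.sum_mem _ fun y _ => Submodule.smul_mem _ _ ?_
    have hU : IsClopen {u : Ultrafilter X | f.1 ⁻¹' {y} ∈ u} :=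
      ⟨ultrafilter_isClosed_basic _, ultrafilter_isOpen_basic _⟩
    refine ⟨LocallyConstant.charFn R hU, ?_⟩
    ext x
    change Set.indicator {u : Ultrafilter X | f.1 ⁻¹' {y} ∈ u} (1 : Ultrafilter X → R) (pure x) =
      Set.indicator (f.1 ⁻¹' {y}) 1 x
    simp [Set.indicator_apply]

/-- The space of ultrafilters is profinite, so Nöbeling's theorem applies to its integer-valued
locally constant functions. -/
lemma free_finValued_int : Module.Free ℤ (finValued ℤ X) := by
  have : Module.Free ℤ (LocallyConstant (Ultrafilter X) ℤ) :=
    LocallyConstant.freeOfProfinite (Profinite.of (Ultrafilter X))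
  exact Module.Free.of_equiv (LinearEquiv.ofBijective _
    (locallyConstantUltrafilterRestrict_bijective ℤ X))

/-- Integer-valued functions as `R`-valued functions. -/
def finValuedCast : finValued ℤ X →ₗ[ℤ] finValued R X where
  toFun f := ⟨fun x => (f.1 x : R), (f.2.image (Int.cast : ℤ → R)).subset (by
    rintro _ ⟨x, rfl⟩
    exact ⟨f.1 x, ⟨x, rfl⟩, rfl⟩)⟩
  map_add' f g := by ext x; simp
  map_smul' n f := by ext x; simp

/-- Base change from integer-valued functions. -/
noncomputable def finValuedBaseChange : R ⊗[ℤ] finValued ℤ X →ₗ[R] finValued R X :=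
  (finValuedCast R X).liftBaseChange R

variable {R X}

lemma finValuedBaseChange_tmul_apply (r : R) (f : finValued ℤ X) (x : X) :
    (finValuedBaseChange R X (r ⊗ₜ f)).1 x = r * (f.1 x : R) := rfl

lemma finValuedBaseChange_tmul_indicator (r : R) (s : Set X) :
    finValuedBaseChange R X (r ⊗ₜ finValuedIndicator ℤ s) = r • finValuedIndicator R s := by
  ext x
  rw [finValuedBaseChange_tmul_apply]
  by_cases h : x ∈ s <;> simp [finValuedIndicator, h]

lemma finValuedBaseChange_bijective : Function.Bijective (finValuedBaseChange R X) := by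
  classical
  constructor
  · rw [injective_iff_map_eq_zero]
    intro t ht
    obtain ⟨S, hS⟩ := TensorProduct.exists_finset t
    -- `φ` records the values of all functions occurring in `t` at once. Its finitely many fibres
    -- are disjoint, and `t` becomes a combination of their indicators.
    let φ : X → S → ℤ := fun x i => i.1.2.1 x
    have hφ : (Set.range φ).Finite :=
      (Set.Finite.pi' fun i : S => i.1.2.2).subset (by
        rintro _ ⟨x, rfl⟩ i
        exact ⟨x, rfl⟩)
    have key : t = ∑ y ∈ hφ.toFinset,
        (∑ i : S, i.1.1 * (y i : R)) ⊗ₜ[ℤ] finValuedIndicator ℤ (φ ⁻¹' {y}) := by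
      rw [hS, ← Finset.sum_coe_sort]
      simp_rw [TensorProduct.sum_tmul]
      rw [Finset.sum_comm]
      refine Finset.sum_congr rfl fun i _ => ?_
      conv_lhs => rw [eq_sum_smul_finValuedIndicator hφ (fun y => y i) i.1.2 fun _ => rfl]
      rw [TensorProduct.tmul_sum]
      refine Finset.sum_congr rfl fun y _ => ?_
      rw [← TensorProduct.smul_tmul, zsmul_eq_mul, mul_comm]
    rw [key]
    refine Finset.sum_eq_zero fun y hy => ?_
    -- Evaluating the image of `t` at a point of the fibre gives the coefficient of that fibre.
    obtain ⟨x, rfl⟩ := hφ.mem_toFinset.1 hy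
    have hx := congrFun (congrArg Subtype.val ht) x
    rw [hS, map_sum, AddSubmonoidClass.coe_finsetSum, Finset.sum_apply,
      ← Finset.sum_coe_sort] at hx
    have h0 : ∑ i : S, i.1.1 * (φ x i : R) = 0 := hx
    rw [h0, TensorProduct.zero_tmul]
  · rw [← LinearMap.range_eq_top, eq_top_iff]
    rintro f -
    rw [eq_sum_smul_finValuedIndicator f.2 id f fun _ => rfl]
    exact Submodule.sum_mem _ fun y _ => ⟨y ⊗ₜ _, finValuedBaseChange_tmul_indicator _ _⟩

variable (R X)

/-- The module of finitely-valued functions is free, by Nöbeling's theorem. -/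
theorem free_finValued : Module.Free R (finValued R X) := by
  have := free_finValued_int X
  exact Module.Free.of_equiv (LinearEquiv.ofBijective _ finValuedBaseChange_bijective)

end FiniteValued

/-! ### The diagonal tensor-Hom adjunction and the algebra structure of `B`. -/

section Diagonal

open TensorProduct Representation

universe w

variable {k : Type u} [CommRing k] {G : Type v} [Group G]

/-- The functor `X ↦ X ⊗ₖ A` on representations, with the diagonal action. -/
noncomputable def repTensorRight (A : Rep.{w} k G) : Rep.{w} k G ⥤ Rep.{w} k G where
  obj X := Rep.of (X.ρ.tprod A.ρ)
  map f := Rep.ofHom ⟨f.hom.toLinearMap.rTensor A.V, fun g => TensorProduct.ext' fun x a => by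
    simp [Rep.hom_comm_apply]⟩
  map_id X := Rep.hom_ext <| IntertwiningMap.ext <| TensorProduct.ext' fun _ _ => rfl
  map_comp f g := Rep.hom_ext <| IntertwiningMap.ext <| TensorProduct.ext' fun _ _ => rfl

/-- Maps `X ⊗ₖ A ⟶ N` of representations correspond to maps `X ⟶ Homₖ(A, N)`. -/
noncomputable def repTensorHomEquiv (A X N : Rep.{w} k G) :
    ((repTensorRight A).obj X ⟶ N) ≃ (X ⟶ (Rep.ihom A).obj N) where
  toFun f := Rep.ofHom ⟨TensorProduct.curry f.hom.toLinearMap, fun g => by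
    refine LinearMap.ext fun x => LinearMap.ext fun a => ?_
    change f.hom (X.ρ g x ⊗ₜ[k] a) = N.ρ g (f.hom (x ⊗ₜ[k] A.ρ g⁻¹ a))
    refine Eq.trans ?_ (Rep.hom_comm_apply f g (x ⊗ₜ[k] A.ρ g⁻¹ a))
    change _ = f.hom (X.ρ g x ⊗ₜ[k] A.ρ g (A.ρ g⁻¹ a))
    rw [Representation.self_inv_apply]⟩
  invFun f := Rep.ofHom ⟨TensorProduct.lift f.hom.toLinearMap, fun g =>
    TensorProduct.ext' fun x a => by
      let F : X.V →ₗ[k] A.V →ₗ[k] N.V := f.hom.toLinearMap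
      have h : F (X.ρ g x) (A.ρ g a) = N.ρ g (F x (A.ρ g⁻¹ (A.ρ g a))) :=
        LinearMap.congr_fun (Rep.hom_comm_apply f g x) (A.ρ g a)
      rwa [Representation.inv_self_apply] at h⟩
  left_inv f := Rep.hom_ext <| IntertwiningMap.ext <| TensorProduct.ext' fun _ _ => rfl
  right_inv f := Rep.hom_ext <| IntertwiningMap.ext <| LinearMap.ext fun _ => rfl

/-- The adjunction between `- ⊗ₖ A` and `Homₖ(A, -)` on representations. -/
noncomputable def repTensorHomAdjunction (A : Rep.{w} k G) : repTensorRight A ⊣ Rep.ihom A :=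
  Adjunction.mkOfHomEquiv
    { homEquiv := repTensorHomEquiv A
      homEquiv_naturality_left_symm := fun _ _ =>
        Rep.hom_ext <| IntertwiningMap.ext <| TensorProduct.ext' fun _ _ => rfl
      homEquiv_naturality_right := fun _ _ => rfl }

lemma preservesMonomorphisms_repTensorRight (A : Rep.{w} k G) [Module.Flat k A.V] :
    (repTensorRight A).PreservesMonomorphisms where
  preserves f _ := (Rep.mono_iff_injective _).2
    (Module.Flat.rTensor_preserves_injective_linearMap f.hom.toLinearMap
      ((Rep.mono_iff_injective f).1 inferInstance))

lemma preservesEpimorphisms_ihom (A : Rep.{w} k G) [Module.Projective k A.V] :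
    (Rep.ihom A).PreservesEpimorphisms where
  preserves f _ := (Rep.epi_iff_surjective _).2 fun φ => by
    obtain ⟨ψ, hψ⟩ := Module.projective_lifting_property f.hom.toLinearMap φ
      ((Rep.epi_iff_surjective f).1 inferInstance)
    exact ⟨ψ, hψ⟩

/-- The structure on a representation `A` that `B` has as an algebra: an equivariant right
multiplication with a unit that `k` splits off from. -/
structure UnitalMulData (A : Rep.{w} k G) where
  /-- The multiplication. -/
  mul : A.V →ₗ[k] A.V →ₗ[k] A.V
  /-- The unit. -/
  one : A.V
  /-- A functional with value one at the unit. -/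
  eval : A.V →ₗ[k] k
  smul_mul (g : G) (a b : A.V) : A.ρ g (mul a b) = mul (A.ρ g a) (A.ρ g b)
  smul_one (g : G) : A.ρ g one = one
  mul_one (a : A.V) : mul a one = a
  eval_one : eval one = 1

namespace UnitalMulData

variable {A : Rep.{w} k G} (μ : UnitalMulData A)

/-- Transport of the structure along an isomorphism. -/
def ofEquiv {A' : Rep.{w} k G} (e : A.ρ.Equiv A'.ρ) : UnitalMulData A' where
  mul := (μ.mul.compl₁₂ e.symm.toLinearMap e.symm.toLinearMap).compr₂ e.toLinearMap
  one := e μ.one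
  eval := μ.eval ∘ₗ e.symm.toLinearMap
  smul_mul g a b := by
    have h (c : A.V) : A'.ρ g (e c) = e (A.ρ g c) :=
      (IntertwiningMap.isIntertwining _ _ e.toIntertwiningMap g c).symm
    have h' (c : A'.V) : e.symm (A'.ρ g c) = A.ρ g (e.symm c) :=
      IntertwiningMap.isIntertwining _ _ e.symm.toIntertwiningMap g c
    change A'.ρ g (e (μ.mul (e.symm a) (e.symm b))) =
      e (μ.mul (e.symm (A'.ρ g a)) (e.symm (A'.ρ g b)))
    rw [h, h', h', μ.smul_mul]
  smul_one g := by
    refine (IntertwiningMap.isIntertwining _ _ e.toIntertwiningMap g μ.one).symm.trans ?_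
    rw [μ.smul_one]
    rfl
  mul_one a := by
    simp [μ.mul_one]
  eval_one := by
    simp [μ.eval_one]

/-- The map `Homₖ(A, M) ⟶ M` evaluating at the unit. -/
noncomputable def ε (M : Rep.{w} k G) : (Rep.ihom A).obj M ⟶ M :=
  Rep.ofHom ⟨LinearMap.applyₗ μ.one, fun g => by
    ext f
    simp [μ.smul_one]⟩

/-- The map `Homₖ(A, M) ⟶ Homₖ(A, Homₖ(A, M))` induced by the multiplication. -/
noncomputable def δ (M : Rep.{w} k G) : (Rep.ihom A).obj M ⟶ (Rep.ihom A).obj ((Rep.ihom A).obj M) :=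
  Rep.ofHom ⟨
    { toFun f := μ.mul.compr₂ f
      map_add' _ _ := rfl
      map_smul' _ _ := rfl }, fun g => by
    refine LinearMap.ext fun f => LinearMap.ext fun a => LinearMap.ext fun b => ?_
    change M.ρ g (f (A.ρ g⁻¹ (μ.mul a b))) = M.ρ g (f (μ.mul (A.ρ g⁻¹ a) (A.ρ g⁻¹ b)))
    rw [μ.smul_mul]⟩

lemma δ_comp_map_ε (M : Rep.{w} k G) : μ.δ M ≫ (Rep.ihom A).map (μ.ε M) = 𝟙 _ :=
  Rep.hom_ext <| IntertwiningMap.ext <| 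
    LinearMap.ext fun (f : A.V →ₗ[k] M.V) => LinearMap.ext fun a => congrArg f (μ.mul_one a)

/-- The `k`-linear map `a ↦ μ.eval a • m` is a preimage of `m`; `μ.eval` need not be equivariant. -/
lemma epi_ε (M : Rep.{w} k G) : Epi (μ.ε M) :=
  (Rep.epi_iff_surjective _).2 fun m => ⟨μ.eval.smulRight m, by
    change μ.eval μ.one • m = m
    rw [μ.eval_one, one_smul]⟩

/-- The map `M ⟶ M ⊗ₖ A` given by the unit. -/
noncomputable def η (M : Rep.{w} k G) : M ⟶ (repTensorRight A).obj M :=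
  Rep.ofHom ⟨(TensorProduct.mk k M.V A.V).flip μ.one, fun g => by
    ext x
    simp [μ.smul_one]⟩

lemma mono_η (M : Rep.{w} k G) : Mono (μ.η M) :=
  (Rep.mono_iff_injective _).2 <| Function.LeftInverse.injective
    (g := fun t => TensorProduct.rid k M.V (μ.eval.lTensor M.V t)) fun x => by
      change TensorProduct.rid k M.V (x ⊗ₜ μ.eval μ.one) = x
      rw [μ.eval_one, TensorProduct.rid_tmul, one_smul]

end UnitalMulData

/-- Multiplication of functions makes `B` a representation with a unital multiplication. -/
def finValuedUnitalMulData : UnitalMulData (Rep.of (finValuedRep k G)) where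
  mul := LinearMap.mk₂ k
    (fun a b => ⟨a.1 * b.1, (Set.Finite.image2 (· * ·) a.2 b.2).subset (by
      rintro _ ⟨x, rfl⟩
      exact ⟨a.1 x, ⟨x, rfl⟩, b.1 x, ⟨x, rfl⟩, rfl⟩)⟩)
    (fun a b c => Subtype.ext (add_mul _ _ _)) (fun r a b => Subtype.ext (smul_mul_assoc _ _ _))
    (fun a b c => Subtype.ext (mul_add _ _ _)) (fun r a b => Subtype.ext (mul_smul_comm _ _ _))
  one := ⟨1, (Set.finite_singleton (1 : k)).subset (by rintro _ ⟨x, rfl⟩; simp)⟩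
  eval := LinearMap.proj 1 ∘ₗ (finValued k G).subtype
  smul_mul g a b := rfl
  smul_one g := rfl
  mul_one a := Subtype.ext (_root_.mul_one a.1)
  eval_one := rfl

end Diagonal

/-! ### The two functors on `kG`-modules. -/

section Modules

variable (k : Type u) [CommRing k] (G : Type v) [Group G]

/-- `B`, as a representation recovered from the module `moduleB`. -/
noncomputable abbrev repB : Rep.{max u v} k G := Rep.ofModuleMonoidAlgebra.obj (moduleB k G)

/-- The representation on `repB` is the one on finitely-valued functions. -/
noncomputable def repBEquiv : (finValuedRep k G).Equiv (repB k G).ρ :=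
  Representation.equivOfIso (Rep.unitIso (Rep.of (finValuedRep k G)))

lemma free_repB : Module.Free k (repB k G).V :=
  have := free_finValued k G
  Module.Free.of_equiv (repBEquiv k G).toLinearEquiv

/-- The functor `M ↦ M ⊗ₖ B` on `kG`-modules. -/
noncomputable def diagTensorB :
    ModuleCat.{max u v} (MonoidAlgebra k G) ⥤ ModuleCat.{max u v} (MonoidAlgebra k G) :=
  Rep.equivalenceModuleMonoidAlgebra.inverse ⋙ repTensorRight (repB k G) ⋙
    Rep.equivalenceModuleMonoidAlgebra.functor

/-- The functor `M ↦ Homₖ(B, M)` on `kG`-modules. -/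
noncomputable def diagHomB :
    ModuleCat.{max u v} (MonoidAlgebra k G) ⥤ ModuleCat.{max u v} (MonoidAlgebra k G) :=
  Rep.equivalenceModuleMonoidAlgebra.inverse ⋙ Rep.ihom (repB k G) ⋙
    Rep.equivalenceModuleMonoidAlgebra.functor

/-- The adjunction between `- ⊗ₖ B` and `Homₖ(B, -)` on `kG`-modules. -/
noncomputable def diagTensorHomAdjunction : diagTensorB k G ⊣ diagHomB k G :=
  Rep.equivalenceModuleMonoidAlgebra.symm.toAdjunction.comp
    ((repTensorHomAdjunction (repB k G)).comp Rep.equivalenceModuleMonoidAlgebra.toAdjunction)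

end Modules

/-! ### Transport along the equivalence of representations with modules. -/

section Conjugation

variable {C D : Type*} [Category* C] [Category* D] (e : C ≌ D) (H : C ⥤ C)

/-- An epimorphism `ε : H X ⟶ X` with `H(ε)` split transports along an equivalence. -/
lemma exists_epi_comp_map_eq_id_of_equivalence (M : D)
    (ε : H.obj (e.inverse.obj M) ⟶ e.inverse.obj M) (hε : Epi ε)
    (δ : H.obj (e.inverse.obj M) ⟶ H.obj (H.obj (e.inverse.obj M)))
    (h : δ ≫ H.map ε = 𝟙 _) :
    ∃ (ε' : (e.inverse ⋙ H ⋙ e.functor).obj M ⟶ M)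
      (δ' : (e.inverse ⋙ H ⋙ e.functor).obj M ⟶
        (e.inverse ⋙ H ⋙ e.functor).obj ((e.inverse ⋙ H ⋙ e.functor).obj M)),
      Epi ε' ∧ δ' ≫ (e.inverse ⋙ H ⋙ e.functor).map ε' = 𝟙 _ := by
  -- Iterating the conjugated functor leaves `e.functor ⋙ e.inverse` in the middle; the unit inserts
  -- it, and a triangle identity cancels it in `key`.
  refine ⟨e.functor.map ε ≫ e.counit.app M, e.functor.map (δ ≫ H.map (e.unit.app _)),
    epi_comp (e.functor.map ε) (e.counit.app M), ?_⟩
  have key : e.unit.app (H.obj (e.inverse.obj M)) ≫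
      e.inverse.map (e.functor.map ε ≫ e.counit.app M) = ε := by
    rw [Functor.map_comp, ← Category.assoc]
    refine (congrArg (· ≫ _) (e.unit_naturality ε)).trans ?_
    rw [Category.assoc, e.unit_inverse_comp]
    exact Category.comp_id ε
  rw [Functor.comp_map, Functor.comp_map]
  refine (e.functor.map_comp _ _).symm.trans ((congrArg e.functor.map ?_).trans
    (e.functor.map_id (H.obj (e.inverse.obj M))))
  refine (Category.assoc _ _ _).trans ?_
  refine (congrArg (δ ≫ ·) ((H.map_comp _ _).symm.trans (congrArg H.map key))).trans h

/-- A monomorphism `X ⟶ H X` transports along an equivalence. -/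
lemma exists_mono_of_equivalence (M : D)
    (η : e.inverse.obj M ⟶ H.obj (e.inverse.obj M)) (hη : Mono η) :
    ∃ η' : M ⟶ (e.inverse ⋙ H ⋙ e.functor).obj M, Mono η' :=
  ⟨e.counitInv.app M ≫ e.functor.map η, mono_comp (e.counitInv.app M) (e.functor.map η)⟩

end Conjugation

/-! ### The cotorsion pair of fibrant modules. -/

section Modules

variable (k : Type u) [CommRing k] (G : Type v) [Group G]

instance : (diagTensorB k G).PreservesMonomorphisms := by
  have := free_repB k G
  have := preservesMonomorphisms_repTensorRight (repB k G)
  unfold diagTensorB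
  infer_instance

instance : (diagHomB k G).PreservesEpimorphisms := by
  have := free_repB k G
  have := preservesEpimorphisms_ihom (repB k G)
  unfold diagHomB
  infer_instance

instance : (diagHomB k G).PreservesZeroMorphisms :=
  have := (diagTensorHomAdjunction k G).isRightAdjoint
  inferInstance

variable {k G}

lemma injectives_iff_injective {R : Type u} [Ring R] (M : ModuleCat.{v} R) :
    injectives M ↔ Injective M :=
  Module.injective_iff_injective_object R M

lemma fibrants_iff (M : ModuleCat.{max u v} (MonoidAlgebra k G)) :
    fibrants k G M ↔ Injective ((diagHomB k G).obj M) :=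
  injectives_iff_injective _

/-- `diagTensor` and `diagHom` with `moduleB` are by definition the values of `diagTensorB` and
`diagHomB`. -/
lemma subsingleton_ext_diagTensor_iff (X D : ModuleCat.{max u v} (MonoidAlgebra k G)) :
    Subsingleton (Abelian.Ext.{max u v} (diagTensor X (moduleB k G)) D 1) ↔
      Subsingleton (Abelian.Ext.{max u v} X (diagHom (moduleB k G) D) 1) :=
  subsingleton_ext_one_adjunction_iff (diagTensorHomAdjunction k G) X D

/-- Tensor products with `B` are left orthogonal to fibrant modules. -/
lemma leftOrth_fibrants_diagTensor (X : ModuleCat.{max u v} (MonoidAlgebra k G)) :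
    leftOrth (fibrants k G) (diagTensor X (moduleB k G)) := fun D hD =>
  have : Injective (diagHom (moduleB k G) D) := (fibrants_iff D).1 hD
  (subsingleton_ext_diagTensor_iff X D).2
    (subsingleton_of_forall_eq 0 Abelian.Ext.eq_zero_of_injective)

/-- Fibrant modules are characterised by the tensor products of cyclic modules with `B`. -/
lemma rightOrth_cyclic_diagTensor {T : Set (ModuleCat.{max u v} (MonoidAlgebra k G))}
    (hT : IsSetOfCyclicRepresentatives T) :
    rightOrth (fun X => X ∈ {X | ∃ C ∈ T, X = diagTensor C (moduleB k G)}) = fibrants k G := by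
  ext D
  constructor
  · refine fun h => injective_of_subsingleton_ext_cyclic _ fun C hC => ?_
    obtain ⟨C', hC', ⟨e⟩⟩ := hT.exists_iso C hC
    have := (subsingleton_ext_diagTensor_iff C' D).1 (h _ ⟨C', hC', rfl⟩)
    exact subsingleton_ext_of_retract ⟨e.hom, e.inv, e.hom_inv_id⟩ _ 1
  · rintro hD _ ⟨C, -, rfl⟩
    exact leftOrth_fibrants_diagTensor C D hD

/-- The unital multiplication on `B` as a representation recovered from `moduleB`. -/
noncomputable def repBUnitalMulData : UnitalMulData (repB k G) :=
  finValuedUnitalMulData.ofEquiv (repBEquiv k G)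

/-- The evaluation `Homₖ(B, M) ⟶ M` at the constant function `1` is an epimorphism, and
`Homₖ(B, Homₖ(B, M)) ⟶ Homₖ(B, M)` is split by the map that the multiplication of `B` induces. -/
lemma exists_epi_comp_map_diagHomB (M : ModuleCat.{max u v} (MonoidAlgebra k G)) :
    ∃ (ε : (diagHomB k G).obj M ⟶ M)
      (δ : (diagHomB k G).obj M ⟶ (diagHomB k G).obj ((diagHomB k G).obj M)),
      Epi ε ∧ δ ≫ (diagHomB k G).map ε = 𝟙 _ := by
  let X := Rep.equivalenceModuleMonoidAlgebra.inverse.obj M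
  have h := repBUnitalMulData.δ_comp_map_ε X
  have := exists_epi_comp_map_eq_id_of_equivalence Rep.equivalenceModuleMonoidAlgebra
    (Rep.ihom (repB k G)) M (repBUnitalMulData.ε X) (repBUnitalMulData.epi_ε X)
    (repBUnitalMulData.δ X) h
  unfold diagHomB
  exact this

/-- The map `M ⟶ M ⊗ₖ B`, `x ↦ x ⊗ 1`, is a monomorphism. -/
lemma exists_mono_diagTensorB (M : ModuleCat.{max u v} (MonoidAlgebra k G)) :
    ∃ η : M ⟶ (diagTensorB k G).obj M, Mono η :=
  exists_mono_of_equivalence Rep.equivalenceModuleMonoidAlgebra (repTensorRight (repB k G)) M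
    (repBUnitalMulData.η _) (repBUnitalMulData.mono_η _)

variable (k G)

lemma leftOrth_fibrants_inf_fibrants : leftOrth (fibrants k G) ⊓ fibrants k G = injectives := by
  ext M
  constructor
  · rintro ⟨hC, hD⟩
    have := (fibrants_iff M).1 hD
    obtain ⟨ε, δ, _, h⟩ := exists_epi_comp_map_diagHomB M
    exact (injectives_iff_injective M).2 (injective_of_subsingleton_ext
      (diagTensorHomAdjunction k G) ε δ h
      fun D hD => hC D ((fibrants_iff D).2 hD))
  · intro hM
    have := (injectives_iff_injective M).1 hM
    refine ⟨fun D hD => ?_, (fibrants_iff M).2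
      (Injective.injective_of_adjoint (diagTensorHomAdjunction k G) M)⟩
    have := (fibrants_iff D).1 hD
    obtain ⟨η, _⟩ := exists_mono_diagTensorB M
    exact subsingleton_ext_of_injective_of_mono (diagTensorHomAdjunction k G) η D

lemma isHereditary_leftOrth_fibrants : IsHereditary (leftOrth (fibrants k G)) (fibrants k G) := by
  rintro C D hC hD (_ | n) hn
  · exact absurd hn (lt_irrefl 0)
  · exact subsingleton_ext_of_injective_rightAdjoint_obj (diagTensorHomAdjunction k G)
      (fun D' hD' => hC D' ((fibrants_iff D').2 hD')) n D ((fibrants_iff D).1 hD)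

lemma isCotorsionPair_leftOrth_fibrants :
    IsCotorsionPair (leftOrth (fibrants k G)) (fibrants k G) where
  left_eq := rfl
  right_eq := by
    obtain ⟨T, hT⟩ := exists_isSetOfCyclicRepresentatives (R := MonoidAlgebra k G)
    ext D
    refine ⟨fun h => ?_, fun hD C hC => hC D hD⟩
    -- It suffices to test `D` against the modules `C ⊗ₖ B`, all of which lie in the left class.
    rw [← rightOrth_cyclic_diagTensor hT]
    rintro _ ⟨C, -, rfl⟩
    exact h _ (leftOrth_fibrants_diagTensor C)

lemma isCogeneratedBySet_leftOrth_fibrants {T : Set (ModuleCat.{max u v} (MonoidAlgebra k G))}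
    (hT : IsSetOfCyclicRepresentatives T) :
    IsCogeneratedBySet (leftOrth (fibrants k G)) (fibrants k G)
      {X | ∃ C ∈ T, X = diagTensor C (moduleB k G)} where
  small := by
    have := hT.small
    have h : {X | ∃ C ∈ T, X = diagTensor C (moduleB k G)} =
        (fun C => diagTensor C (moduleB k G)) '' T := by
      ext X
      simp [eq_comm]
    rw [h]
    infer_instance
  right_eq := (rightOrth_cyclic_diagTensor hT).symm
  left_eq := by rw [rightOrth_cyclic_diagTensor hT]

end Modules

end CotorsionPairs

theorem theorem4p5 (k : Type u) [CommRing k] (G : Type v) [Group G] :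
    IsCotorsionPair (leftOrth (fibrants k G)) (fibrants k G) ∧
    IsHereditary (leftOrth (fibrants k G)) (fibrants k G) ∧
    (∃ T : Set (ModuleCat.{max u v} (MonoidAlgebra k G)), IsSetOfCyclicRepresentatives T) ∧
    (∀ T : Set (ModuleCat.{max u v} (MonoidAlgebra k G)), IsSetOfCyclicRepresentatives T →
      IsCogeneratedBySet (leftOrth (fibrants k G)) (fibrants k G)
        {X | ∃ C ∈ T, X = diagTensor C (moduleB k G)}) ∧
    leftOrth (fibrants k G) ⊓ fibrants k G = injectives :=
  ⟨isCotorsionPair_leftOrth_fibrants k G, isHereditary_leftOrth_fibrants k G,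
    exists_isSetOfCyclicRepresentatives, fun _ hT => isCogeneratedBySet_leftOrth_fibrants k G hT,
    leftOrth_fibrants_inf_fibrants k G⟩
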